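/- Let $n\ge 3$. Let $\mathbb{L}(n)\subset\mathbb{C}^n$ be the set of all $n$-segments, i.e. of all $(z_1,\dots,z_n)\in\mathbb{C}^n$ such that the points $z_1,\dots,z_n$ lie on a common real line in the plane $\mathbb{C}$ and are not all equal, and let $\mathbb{M}(n)=\{(z_1,\dots,z_n)\in\mathbb{L}(n) : z_1=0\}$. Then $\mathbb{M}(n)$ and $\mathbb{L}(n)$ are smooth ($C^\infty$) real embedded submanifolds of $\mathbb{C}^n$, of real dimensions $n$ and $n+2$ respectively, and the map $$\mathbb{M}(n)\times\mathbb{C}\to\mathbb{L}(n),\qquad (Z,b)\mapsto Z+(b,\dots,b),$$ is a diffeomorphism. In particular $\mathbb{L}(n)$ is diffeomorphic to $\mathbb{M}(n)\times\mathbb{C}$. -/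

import Mathlib

open scoped Manifold ContDiff

/-- The diagonal of `ℂⁿ`: the polygons all of whose vertices coincide. -/
def polygonDiagonal (n : ℕ) : Set (Fin n → ℂ) :=
  Set.range fun (b : ℂ) (_ : Fin n) => b

/-- The space `𝕃(n) ⊂ ℂⁿ` of `n`-segments: polygons whose vertices lie on a common real line of
the plane, and do not all coincide. -/
def segmentSpace (n : ℕ) : Set (Fin n → ℂ) :=
  {z | Collinear ℝ (Set.range z) ∧ z ∉ polygonDiagonal n}

/-- The subspace `V_n ⊂ ℂⁿ` of polygons whose first vertex (the one of index `0`) is the origin. -/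
def firstVertexZero (n : ℕ) : Set (Fin n → ℂ) :=
  {z | ∀ i : Fin n, (i : ℕ) = 0 → z i = 0}

/-- The space `𝕄(n) = 𝕃(n) ∩ V_n` of `n`-segments whose first vertex is the origin. -/
def basedSegmentSpace (n : ℕ) : Set (Fin n → ℂ) :=
  segmentSpace n ∩ firstVertexZero n

/-- The given charts on the subset `S` (with its subspace topology) make `S` a smooth
`d`-dimensional embedded submanifold of the real normed space `E`: they are smoothly compatible,
and the inclusion `S → E` is a smooth embedding. (For given `S` there is at most one
smooth structure with this property.) -/
structure IsEmbeddedSubmanifold {E : Type*} [NormedAddCommGroup E] [NormedSpace ℝ E]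
    (d : ℕ) (S : Set E) [ChartedSpace (EuclideanSpace ℝ (Fin d)) S] : Prop where
  isManifold : IsManifold (𝓡 d) ∞ S
  isSmoothEmbedding : Manifold.IsSmoothEmbedding (𝓡 d) 𝓘(ℝ, E) ∞ (Subtype.val : S → E)

/-! A non-constant polygon has some vertex `k` with `z k ≠ z 0`. On this open set, `z 0`, `z k - z
0` and the ratios `(z i - z 0) / (z k - z 0)` are smooth coordinates of `ℂⁿ`, and the vertices are
collinear iff every ratio is real. So `𝕃(n)` is straightened to `ℂ × ℂ × ℝⁿ⁻²`, and `𝕄(n)`, where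
also `z 0 = 0`, to `0 × ℂ × ℝⁿ⁻²` (`segmentChart_mem_segmentSlice_iff`). Sets locally straightened
by ambient charts are embedded submanifolds (`exists_isEmbeddedSubmanifold`). Translation and its
inverse `z ↦ (z - z 0, z 0)` are restrictions of linear maps, and smoothness into an embedded
submanifold can be tested in the ambient space. -/

open Module Topology

/-! ### Submanifold structure from slice charts. -/

section Slice

variable {E F G : Type*} [NormedAddCommGroup E] [NormedSpace ℝ E]
  [NormedAddCommGroup F] [NormedSpace ℝ F] [NormedAddCommGroup G] [NormedSpace ℝ G]

/-- A slice chart for `S ⊆ E`: a smooth chart of `E` which, after the linear identification of `E`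
with `F × G`, straightens `S` to `F × {0}`. -/
structure SliceChart (F G : Type*) [NormedAddCommGroup F] [NormedSpace ℝ F]
    [NormedAddCommGroup G] [NormedSpace ℝ G] (S : Set E) where
  /-- the chart of the ambient space -/
  ambient : OpenPartialHomeomorph E E
  /-- the linear identification of the ambient space with a product -/
  equiv : (F × G) ≃L[ℝ] E
  contDiffOn : ContDiffOn ℝ ∞ ambient ambient.source
  contDiffOn_symm : ContDiffOn ℝ ∞ ambient.symm ambient.target
  mem_iff : ∀ y ∈ ambient.source, y ∈ S ↔ (equiv.symm (ambient y)).2 = 0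

namespace SliceChart

variable {S : Set E}

theorem symm_mem (c : SliceChart F G S) {u : F} (hu : c.equiv (u, 0) ∈ c.ambient.target) :
    c.ambient.symm (c.equiv (u, 0)) ∈ S := by
  rw [c.mem_iff _ (c.ambient.map_target hu), c.ambient.right_inv hu]
  simp

theorem equiv_fst (c : SliceChart F G S) {y : E} (hy : y ∈ c.ambient.source) (hS : y ∈ S) :
    c.equiv ((c.equiv.symm (c.ambient y)).1, 0) = c.ambient y := by
  rw [← (c.mem_iff y hy).1 hS]
  simp

open Classical in
/-- The chart of `S` induced by a slice chart, given a default point of `S`. -/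
noncomputable def chart (c : SliceChart F G S) (x : S) : OpenPartialHomeomorph S F where
  toFun y := (c.equiv.symm (c.ambient y)).1
  -- The value `x` off the target is arbitrary; it only makes the inverse a total map into `S`.
  invFun u := if hu : c.equiv (u, 0) ∈ c.ambient.target then ⟨_, c.symm_mem hu⟩ else x
  source := Subtype.val ⁻¹' c.ambient.source
  target := {u | c.equiv (u, 0) ∈ c.ambient.target}
  map_source' y hy := by
    have hy' : (y : E) ∈ c.ambient.source := hy
    simpa [c.equiv_fst hy' y.2] using c.ambient.map_source hy'
  map_target' u hu := by
    have hu' : c.equiv (u, 0) ∈ c.ambient.target := hu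
    simp [hu']
  left_inv' y hy := by
    have hy' : (y : E) ∈ c.ambient.source := hy
    ext
    simp [c.equiv_fst hy' y.2, hy']
  right_inv' u hu := by
    have hu' : c.equiv (u, 0) ∈ c.ambient.target := hu
    simp [hu']
  open_source := c.ambient.open_source.preimage continuous_subtype_val
  open_target := c.ambient.open_target.preimage (by fun_prop)
  continuousOn_toFun := by
    have h : ContinuousOn (fun y : S => c.ambient y) (Subtype.val ⁻¹' c.ambient.source) :=
      c.ambient.continuousOn.comp continuous_subtype_val.continuousOn fun _ hy => hy
    exact (continuous_fst.comp c.equiv.symm.continuous).comp_continuousOn h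
  continuousOn_invFun := by
    rw [IsInducing.subtypeVal.continuousOn_iff]
    have h : ContinuousOn (fun u : F => c.ambient.symm (c.equiv (u, 0)))
        {u | c.equiv (u, 0) ∈ c.ambient.target} :=
      c.ambient.continuousOn_symm.comp (by fun_prop) fun _ hu => hu
    refine h.congr fun u hu => ?_
    have hu' : c.equiv (u, 0) ∈ c.ambient.target := hu
    simp [hu']

@[simp] theorem chart_source (c : SliceChart F G S) (x : S) :
    (c.chart x).source = Subtype.val ⁻¹' c.ambient.source := rfl

@[simp] theorem chart_target (c : SliceChart F G S) (x : S) :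
    (c.chart x).target = {u | c.equiv (u, 0) ∈ c.ambient.target} := rfl

theorem chart_apply (c : SliceChart F G S) (x y : S) :
    c.chart x y = (c.equiv.symm (c.ambient y)).1 := rfl

theorem coe_chart_symm (c : SliceChart F G S) (x : S) {u : F}
    (hu : c.equiv (u, 0) ∈ c.ambient.target) :
    ((c.chart x).symm u : E) = c.ambient.symm (c.equiv (u, 0)) := by
  classical
  change ((if hu : c.equiv (u, 0) ∈ c.ambient.target then ⟨_, c.symm_mem hu⟩ else x : S) : E) = _
  rw [dif_pos hu]

/-- A change of charts is an ambient change of charts, restricted to `F × {0}` and projected to `F`.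
-/
theorem contDiffOn_chart_trans (c c' : SliceChart F G S) (x x' : S) :
    ContDiffOn ℝ ∞ ((c.chart x).symm.trans (c'.chart x'))
      ((c.chart x).symm.trans (c'.chart x')).source := by
  have h : ContDiffOn ℝ ∞
      (fun u : F => (c'.equiv.symm (c'.ambient (c.ambient.symm (c.equiv (u, 0))))).1)
      ((c.chart x).symm.trans (c'.chart x')).source := by
    have h1 : ContDiff ℝ ∞ (fun u : F => c.equiv (u, 0)) := by fun_prop
    have h2 : ContDiffOn ℝ ∞ (fun u : F => c.ambient.symm (c.equiv (u, 0)))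
        {u | c.equiv (u, 0) ∈ c.ambient.target} :=
      c.contDiffOn_symm.comp h1.contDiffOn fun u hu => hu
    have h3 := c'.contDiffOn.comp (h2.mono (t := ((c.chart x).symm.trans (c'.chart x')).source) ?_)
      ?_
    · have h4 : ContDiff ℝ ∞ (fun v : E => (c'.equiv.symm v).1) := by fun_prop
      exact h4.comp_contDiffOn h3
    · exact fun u hu => hu.1
    · rintro u ⟨hu, hu'⟩
      have hu'' : ((c.chart x).symm u : E) ∈ c'.ambient.source := hu'
      rwa [c.coe_chart_symm x hu] at hu''
  refine h.congr fun u hu => ?_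
  simp only [OpenPartialHomeomorph.coe_trans, Function.comp_apply, chart_apply]
  rw [c.coe_chart_symm x hu.1]

end SliceChart

/-- A set covered by slice charts is a charted space. -/
noncomputable abbrev sliceChartedSpace {S : Set E} (c : S → SliceChart F G S)
    (hc : ∀ x, (x : E) ∈ (c x).ambient.source) : ChartedSpace F S where
  atlas := Set.range fun x => (c x).chart x
  chartAt x := (c x).chart x
  mem_chart_source x := hc x
  chart_mem_atlas x := ⟨x, rfl⟩

theorem isManifold_sliceChartedSpace {S : Set E} (c : S → SliceChart F G S)
    (hc : ∀ x, (x : E) ∈ (c x).ambient.source) :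
    letI := sliceChartedSpace c hc
    IsManifold 𝓘(ℝ, F) ∞ S := by
  let _ := sliceChartedSpace c hc
  refine isManifold_of_contDiffOn _ _ _ ?_
  rintro _ _ ⟨x, rfl⟩ ⟨x', rfl⟩
  simpa using (c x).contDiffOn_chart_trans (c x') x x'

/-- Read in the induced chart and the ambient chart, the inclusion is `u ↦ equiv (u, 0)`, the normal
form of an immersion with complement `G`. -/
theorem isSmoothEmbedding_sliceChartedSpace {S : Set E} (c : S → SliceChart F G S)
    (hc : ∀ x, (x : E) ∈ (c x).ambient.source) :
    letI := sliceChartedSpace c hc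
    Manifold.IsSmoothEmbedding 𝓘(ℝ, F) 𝓘(ℝ, E) ∞ (Subtype.val : S → E) := by
  let _ := sliceChartedSpace c hc
  have := isManifold_sliceChartedSpace c hc
  refine ⟨Manifold.IsImmersionOfComplement.isImmersion (F := G) fun x => ?_, IsEmbedding.subtypeVal⟩
  refine Manifold.IsImmersionAtOfComplement.mk_of_charts (c x).equiv ((c x).chart x) (c x).ambient
    (hc x) (hc x) (IsManifold.chart_mem_maximalAtlas x) ?_ subset_rfl ?_
  · refine StructureGroupoid.mem_maximalAtlas_of_mem_groupoid _ ?_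
    rw [contDiffGroupoid, mem_groupoid_of_pregroupoid]
    simpa [contDiffPregroupoid] using ⟨(c x).contDiffOn, (c x).contDiffOn_symm⟩
  · intro u hu
    have hu' : (c x).equiv (u, 0) ∈ (c x).ambient.target := by simpa using hu
    simp [(c x).coe_chart_symm x hu', hu']

end Slice

/-- A subspace of dimension `d` and codimension `e` of a finite-dimensional normed space is the
first factor in a product decomposition. -/
theorem exists_prod_equiv_snd_eq_zero_iff {E : Type*} [NormedAddCommGroup E] [NormedSpace ℝ E]
    [FiniteDimensional ℝ E] {d e : ℕ} (hE : finrank ℝ E = d + e) (W : Submodule ℝ E)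
    (hW : finrank ℝ W = d) :
    ∃ L : (EuclideanSpace ℝ (Fin d) × EuclideanSpace ℝ (Fin e)) ≃L[ℝ] E,
      ∀ v, (L.symm v).2 = 0 ↔ v ∈ W := by
  obtain ⟨W', h⟩ := W.exists_isCompl
  have hW' : finrank ℝ W' = e := by
    have := Submodule.finrank_add_eq_of_isCompl h
    omega
  let e₁ : EuclideanSpace ℝ (Fin d) ≃ₗ[ℝ] W := LinearEquiv.ofFinrankEq _ _ (by simp [hW])
  let e₂ : EuclideanSpace ℝ (Fin e) ≃ₗ[ℝ] W' := LinearEquiv.ofFinrankEq _ _ (by simp [hW'])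
  refine ⟨((e₁.prodCongr e₂).trans (W.prodEquivOfIsCompl W' h)).toContinuousLinearEquiv,
    fun v => ?_⟩
  have : (((e₁.prodCongr e₂).trans (W.prodEquivOfIsCompl W' h)).toContinuousLinearEquiv.symm v).2
      = e₂.symm ((W.prodEquivOfIsCompl W' h).symm v).2 := rfl
  rw [this, LinearEquiv.map_eq_zero_iff, Submodule.prodEquivOfIsCompl_symm_apply_snd_eq_zero]

/-- A subset of a finite-dimensional normed space that is locally straightened to a `d`-dimensional
subspace by smooth charts of the ambient space is a `d`-dimensional embedded submanifold. -/
theorem exists_isEmbeddedSubmanifold {E : Type*} [NormedAddCommGroup E] [NormedSpace ℝ E]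
    [FiniteDimensional ℝ E] {d e : ℕ} (hE : finrank ℝ E = d + e) {S : Set E}
    (h : ∀ x ∈ S, ∃ (ψ : OpenPartialHomeomorph E E) (W : Submodule ℝ E), x ∈ ψ.source ∧
      ContDiffOn ℝ ∞ ψ ψ.source ∧ ContDiffOn ℝ ∞ ψ.symm ψ.target ∧ finrank ℝ W = d ∧
      ∀ y ∈ ψ.source, y ∈ S ↔ ψ y ∈ W) :
    ∃ _ : ChartedSpace (EuclideanSpace ℝ (Fin d)) S, IsEmbeddedSubmanifold d S := by
  have key : ∀ x : S, ∃ c : SliceChart (EuclideanSpace ℝ (Fin d)) (EuclideanSpace ℝ (Fin e)) S,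
      (x : E) ∈ c.ambient.source := by
    rintro ⟨x, hx⟩
    obtain ⟨ψ, W, hxψ, hψ, hψ', hW, hS⟩ := h x hx
    obtain ⟨L, hL⟩ := exists_prod_equiv_snd_eq_zero_iff hE W hW
    exact ⟨⟨ψ, L, hψ, hψ', fun y hy => (hS y hy).trans (hL _).symm⟩, hxψ⟩
  choose c hc using key
  exact ⟨sliceChartedSpace c hc,
    @IsEmbeddedSubmanifold.mk _ _ _ _ _ (sliceChartedSpace c hc)
      (isManifold_sliceChartedSpace c hc) (isSmoothEmbedding_sliceChartedSpace c hc)⟩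

/-! ### Straightening the space of segments. -/

section Segments

variable {n : ℕ} [NeZero n]

/-- The chart of `ℂⁿ` in which the vertices other than `0` and `k` are replaced by their position
relative to the segment from the vertex `0` to the vertex `k`. -/
noncomputable def segmentChart (k : Fin n) (hk : k ≠ 0) :
    OpenPartialHomeomorph (Fin n → ℂ) (Fin n → ℂ) where
  toFun z i := if i = 0 then z 0 else if i = k then z k - z 0 else (z i - z 0) / (z k - z 0)
  invFun w i := if i = 0 then w 0 else if i = k then w k + w 0 else w i * w k + w 0
  source := {z | z k - z 0 ≠ 0}
  target := {w | w k ≠ 0}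
  map_source' z hz := by simpa [hk] using hz
  map_target' w hw := by simpa [hk] using hw
  left_inv' z hz := by
    have hz' : z k - z 0 ≠ 0 := hz
    ext i
    by_cases hi : i = 0
    · simp [hi]
    by_cases hik : i = k
    · simp [hik, hk]
    · simp [hi, hik, hk, hz']
  right_inv' w hw := by
    have hw' : w k ≠ 0 := hw
    ext i
    by_cases hi : i = 0
    · simp [hi]
    by_cases hik : i = k
    · simp [hik, hk]
    · simp [hi, hik, hk, hw']
  open_source := isOpen_ne_fun (by fun_prop) (by fun_prop)
  open_target := isOpen_ne_fun (by fun_prop) (by fun_prop)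
  continuousOn_toFun := by
    refine continuousOn_pi.2 fun i => ?_
    split_ifs
    · fun_prop
    · fun_prop
    · exact ContinuousOn.div (by fun_prop) (by fun_prop) fun z hz => hz
  continuousOn_invFun := by
    refine continuousOn_pi.2 fun i => ?_
    split_ifs <;> fun_prop

theorem segmentChart_source (k : Fin n) (hk : k ≠ 0) :
    (segmentChart k hk).source = {z | z k - z 0 ≠ 0} := rfl

theorem segmentChart_apply (k : Fin n) (hk : k ≠ 0) (z : Fin n → ℂ) (i : Fin n) :
    segmentChart k hk z i =
      if i = 0 then z 0 else if i = k then z k - z 0 else (z i - z 0) / (z k - z 0) := rfl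

theorem contDiffOn_segmentChart (k : Fin n) (hk : k ≠ 0) :
    ContDiffOn ℝ ∞ (segmentChart k hk) (segmentChart k hk).source := by
  refine contDiffOn_pi.2 fun i => ?_
  change ContDiffOn ℝ ∞ (fun z : Fin n → ℂ =>
    if i = 0 then z 0 else if i = k then z k - z 0 else (z i - z 0) / (z k - z 0)) _
  split_ifs
  · fun_prop
  · fun_prop
  · have h : ContDiffOn ℝ ∞ (fun z : Fin n → ℂ => (z k - z 0)⁻¹) {z | z k - z 0 ≠ 0} :=
      ContDiffOn.inv (by fun_prop) fun z hz => hz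
    simp only [div_eq_mul_inv]
    exact ContDiffOn.mul (by fun_prop) h

theorem contDiffOn_segmentChart_symm (k : Fin n) (hk : k ≠ 0) :
    ContDiffOn ℝ ∞ (segmentChart k hk).symm (segmentChart k hk).target := by
  refine contDiffOn_pi.2 fun i => ?_
  change ContDiffOn ℝ ∞ (fun w : Fin n → ℂ =>
    if i = 0 then w 0 else if i = k then w k + w 0 else w i * w k + w 0) _
  split_ifs <;> fun_prop

/-- The polygons whose vertex `0` lies in `P`, whose vertex `k` is arbitrary, and whose other
vertices are real. -/
noncomputable def segmentSlice (P : Submodule ℝ ℂ) (k : Fin n) : Submodule ℝ (Fin n → ℂ) :=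
  Submodule.pi Set.univ fun i => if i = 0 then P else if i = k then ⊤ else ℝ ∙ (1 : ℂ)

theorem finrank_segmentSlice (P : Submodule ℝ ℂ) (k : Fin n) (hk : k ≠ 0) :
    finrank ℝ (segmentSlice P k) = finrank ℝ P + n := by
  let p : Fin n → Submodule ℝ ℂ := fun i => if i = 0 then P else if i = k then ⊤ else ℝ ∙ (1 : ℂ)
  let e : segmentSlice P k ≃ₗ[ℝ] ∀ i, p i :=
    { toFun := fun w i => ⟨w.1 i, w.2 i trivial⟩
      invFun := fun w => ⟨fun i => w i, fun i _ => (w i).2⟩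
      map_add' := fun _ _ => rfl
      map_smul' := fun _ _ => rfl
      left_inv := fun _ => rfl
      right_inv := fun _ => rfl }
  -- Each vertex counts 1, with 1 more at `k`, and at `0` the 1 is replaced by `finrank ℝ P`. The
  -- subtraction is never truncated, by `hle`, so it commutes with the sum.
  have hp : ∀ i, finrank ℝ (p i) =
      1 + (if i = k then 1 else 0) + (if i = 0 then finrank ℝ P else 0) -
        (if i = 0 then 1 else 0) := by
    intro i
    by_cases hi : i = 0
    · rw [show p i = P by simp [p, hi]]
      simp [hi, hk.symm]
    by_cases hik : i = k
    · rw [show p i = ⊤ by simp [p, hik, hk]]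
      simp [hik, hk, Complex.finrank_real_complex]
    · rw [show p i = ℝ ∙ (1 : ℂ) by simp [p, hi, hik], finrank_span_singleton one_ne_zero]
      simp [hi, hik]
  have hle : ∀ i ∈ (Finset.univ : Finset (Fin n)), (if i = 0 then 1 else 0) ≤
      1 + (if i = k then 1 else 0) + (if i = 0 then finrank ℝ P else 0) := by
    intro i _
    split_ifs <;> omega
  rw [e.finrank_eq, finrank_pi_fintype, Finset.sum_congr rfl fun i _ => hp i,
    Finset.sum_tsub_distrib _ hle]
  simp [Finset.sum_add_distrib]
  omega

theorem segmentChart_mem_segmentSlice_iff (P : Submodule ℝ ℂ) (k : Fin n) (hk : k ≠ 0)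
    {z : Fin n → ℂ} (hz : z k - z 0 ≠ 0) :
    segmentChart k hk z ∈ segmentSlice P k ↔ z ∈ segmentSpace n ∧ z 0 ∈ P := by
  have hdiag : z ∉ polygonDiagonal n := by
    rintro ⟨b, rfl⟩
    simp at hz
  have hmem : segmentChart k hk z ∈ segmentSlice P k ↔
      z 0 ∈ P ∧ ∀ i, ∃ r : ℝ, z i - z 0 = r * (z k - z 0) := by
    simp only [segmentSlice, Submodule.mem_pi, Set.mem_univ, true_implies, segmentChart_apply]
    constructor
    · refine fun h => ⟨by simpa using h 0, fun i => ?_⟩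
      by_cases hi : i = 0
      · exact ⟨0, by simp [hi]⟩
      by_cases hik : i = k
      · exact ⟨1, by simp [hik]⟩
      · have := h i
        simp only [hi, hik, if_false, Submodule.mem_span_singleton] at this
        obtain ⟨r, hr⟩ := this
        exact ⟨r, by rw [← div_eq_iff hz, ← hr]; simp⟩
    · rintro ⟨h0, h⟩ i
      by_cases hi : i = 0
      · simpa [hi] using h0
      by_cases hik : i = k
      · simp [hik, hk]
      · obtain ⟨r, hr⟩ := h i
        simp only [hi, hik, if_false, Submodule.mem_span_singleton]
        exact ⟨r, by rw [hr, mul_div_cancel_right₀ _ hz]; simp⟩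
  rw [hmem, and_comm]
  refine and_congr_left fun _ => ?_
  rw [segmentSpace, Set.mem_ofPred_eq, and_iff_left hdiag,
    collinear_iff_of_mem (Set.mem_range_self (0 : Fin n))]
  simp only [Set.forall_mem_range, vadd_eq_add, Complex.real_smul]
  constructor
  · exact fun h => ⟨z k - z 0, fun i => (h i).imp fun r hr => by rw [← hr]; ring⟩
  -- The direction `v` given by collinearity is arbitrary; since `z k - z 0 = s * v` is nonzero, it
  -- can be rescaled to `z k - z 0`, turning `r` into `r / s`.
  · rintro ⟨v, hv⟩ i
    obtain ⟨s, hs⟩ := hv k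
    obtain ⟨r, hr⟩ := hv i
    have hs' : z k - z 0 = s * v := by rw [hs]; ring
    have hs0 : (s : ℂ) ≠ 0 := fun h => hz (by rw [hs', h, zero_mul])
    refine ⟨r / s, ?_⟩
    rw [hs', hr]
    push_cast
    field_simp
    ring

theorem exists_sub_ne_zero_of_mem_segmentSpace {z : Fin n → ℂ} (hz : z ∈ segmentSpace n) :
    ∃ k, k ≠ 0 ∧ z k - z 0 ≠ 0 := by
  by_contra! h
  refine hz.2 ⟨z 0, funext fun i => ?_⟩
  by_cases hi : i = 0
  · rw [hi]
  · exact (sub_eq_zero.1 (h i hi)).symm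

theorem mem_firstVertexZero {z : Fin n → ℂ} : z ∈ firstVertexZero n ↔ z 0 = 0 := by
  refine ⟨fun h => h 0 (by simp), fun h i hi => ?_⟩
  rwa [show i = 0 from Fin.ext (by simpa using hi)]

theorem add_const_mem_segmentSpace {z : Fin n → ℂ} (hz : z ∈ segmentSpace n) (b : ℂ) :
    (z + fun _ => b) ∈ segmentSpace n := by
  obtain ⟨k, hk, hzk⟩ := exists_sub_ne_zero_of_mem_segmentSpace hz
  obtain ⟨v, hv⟩ := (collinear_iff_of_mem (Set.mem_range_self (0 : Fin n))).1 hz.1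
  refine ⟨(collinear_iff_of_mem (Set.mem_range_self (0 : Fin n))).2 ⟨v, ?_⟩, ?_⟩
  · rintro _ ⟨i, rfl⟩
    obtain ⟨r, hr⟩ := hv _ ⟨i, rfl⟩
    exact ⟨r, by simp only [vadd_eq_add] at hr ⊢; simp only [Pi.add_apply, hr]; ring⟩
  · rintro ⟨c, hc⟩
    have h0 := congrFun hc 0
    have h1 := congrFun hc k
    simp only [Pi.add_apply] at h0 h1
    exact hzk (by linear_combination h0 - h1)

/-- Treats both spaces at once: `P = ⊥` gives `𝕄(n)` and `P = ⊤` gives `𝕃(n)`. The codimension `e`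
comes from `2 * n = (finrank ℝ P + n) + e`. -/
theorem exists_isEmbeddedSubmanifold_segment (P : Submodule ℝ ℂ) {e : ℕ} {S : Set (Fin n → ℂ)}
    (he : finrank ℝ P + e = n) (hS : ∀ z, z ∈ S ↔ z ∈ segmentSpace n ∧ z 0 ∈ P) :
    ∃ _ : ChartedSpace (EuclideanSpace ℝ (Fin (finrank ℝ P + n))) S,
      IsEmbeddedSubmanifold (finrank ℝ P + n) S := by
  refine exists_isEmbeddedSubmanifold (e := e) ?_ fun z hz => ?_
  · rw [finrank_pi_fintype]
    simp [Complex.finrank_real_complex]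
    omega
  · obtain ⟨k, hk, hzk⟩ := exists_sub_ne_zero_of_mem_segmentSpace ((hS z).1 hz).1
    exact ⟨segmentChart k hk, segmentSlice P k, hzk, contDiffOn_segmentChart k hk,
      contDiffOn_segmentChart_symm k hk, finrank_segmentSlice P k hk, fun y hy =>
        (hS y).trans (segmentChart_mem_segmentSlice_iff P k hk hy).symm⟩

theorem exists_isEmbeddedSubmanifold_basedSegmentSpace :
    ∃ _ : ChartedSpace (EuclideanSpace ℝ (Fin n)) (basedSegmentSpace n),
      IsEmbeddedSubmanifold n (basedSegmentSpace n) := by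
  have h := exists_isEmbeddedSubmanifold_segment (n := n) ⊥ (e := n) (S := basedSegmentSpace n)
    (by simp) fun z => and_congr_right fun _ => by simp [mem_firstVertexZero]
  rwa [show finrank ℝ (⊥ : Submodule ℝ ℂ) + n = n by simp] at h

theorem exists_isEmbeddedSubmanifold_segmentSpace (hn : 2 ≤ n) :
    ∃ _ : ChartedSpace (EuclideanSpace ℝ (Fin (n + 2))) (segmentSpace n),
      IsEmbeddedSubmanifold (n + 2) (segmentSpace n) := by
  have h2 : finrank ℝ (⊤ : Submodule ℝ ℂ) = 2 := by simp [Complex.finrank_real_complex]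
  have h := exists_isEmbeddedSubmanifold_segment (n := n) ⊤ (e := n - 2) (S := segmentSpace n)
    (by omega) fun z => by simp
  rwa [show finrank ℝ (⊤ : Submodule ℝ ℂ) + n = n + 2 by omega] at h

/-! ### The translation diffeomorphism. -/

/-- Translating the based segments, as a bijection. -/
def segmentTranslation (n : ℕ) [NeZero n] : basedSegmentSpace n × ℂ ≃ segmentSpace n where
  toFun p := ⟨(p.1 : Fin n → ℂ) + fun _ => p.2, add_const_mem_segmentSpace p.1.2.1 p.2⟩
  invFun z := ⟨⟨(z : Fin n → ℂ) + fun _ => -(z : Fin n → ℂ) 0,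
    add_const_mem_segmentSpace z.2 _, mem_firstVertexZero.2 (by simp)⟩, (z : Fin n → ℂ) 0⟩
  left_inv p := by
    have h := mem_firstVertexZero.1 p.1.2.2
    ext <;> simp [h]
  right_inv z := by
    ext
    simp

/-- A continuous map into an immersed manifold is smooth once its composite with the immersion is;
here the composites are built from linear maps of `ℂⁿ` and the smooth inclusions. -/
theorem exists_diffeomorph_basedSegmentSpace_prod
    [ChartedSpace (EuclideanSpace ℝ (Fin n)) (basedSegmentSpace n)]
    [ChartedSpace (EuclideanSpace ℝ (Fin (n + 2))) (segmentSpace n)]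
    (hM : IsEmbeddedSubmanifold n (basedSegmentSpace n))
    (hL : IsEmbeddedSubmanifold (n + 2) (segmentSpace n)) :
    ∃ Φ : Diffeomorph ((𝓡 n).prod 𝓘(ℝ, ℂ)) (𝓡 (n + 2))
        (basedSegmentSpace n × ℂ) (segmentSpace n) ∞,
      ∀ (z : basedSegmentSpace n) (b : ℂ),
        (Φ (z, b) : Fin n → ℂ) = (z : Fin n → ℂ) + fun _ => b := by
  have := hM.isManifold
  have := hL.isManifold
  have hMi := hM.isSmoothEmbedding.isImmersion
  have hLi := hL.isSmoothEmbedding.isImmersion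
  have hconst : ContDiff ℝ ∞ fun b : ℂ => (fun _ : Fin n => b) := by fun_prop
  have hzero : ContDiff ℝ ∞ fun z : Fin n → ℂ => z 0 := by fun_prop
  have hsub : ContDiff ℝ ∞ fun z : Fin n → ℂ => z + fun _ => -z 0 := by fun_prop
  refine ⟨⟨segmentTranslation n, ?_, ?_⟩, fun z b => rfl⟩
  · refine (ContMDiff.iff_comp_isImmersion hLi).2 ⟨?_, ?_⟩
    · refine Continuous.subtype_mk ?_ _
      fun_prop
    · exact (hMi.contMDiff.comp contMDiff_fst).add (hconst.contMDiff.comp contMDiff_snd)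
  · refine ContMDiff.prodMk ?_ (hzero.contMDiff.comp hLi.contMDiff)
    refine (ContMDiff.iff_comp_isImmersion hMi).2 ⟨?_, hsub.contMDiff.comp hLi.contMDiff⟩
    exact (hsub.continuous.comp continuous_subtype_val).subtype_mk _

end Segments

theorem corollary2p2 (n : ℕ) (hn : 3 ≤ n) :
    ∃ (_ : ChartedSpace (EuclideanSpace ℝ (Fin n)) (basedSegmentSpace n))
      (_ : ChartedSpace (EuclideanSpace ℝ (Fin (n + 2))) (segmentSpace n)),
      IsEmbeddedSubmanifold n (basedSegmentSpace n) ∧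
      IsEmbeddedSubmanifold (n + 2) (segmentSpace n) ∧
      ∃ Φ : Diffeomorph ((𝓡 n).prod 𝓘(ℝ, ℂ)) (𝓡 (n + 2))
          (basedSegmentSpace n × ℂ) (segmentSpace n) ∞,
        ∀ (z : basedSegmentSpace n) (b : ℂ),
          (Φ (z, b) : Fin n → ℂ) = (z : Fin n → ℂ) + fun _ => b := by
  have : NeZero n := ⟨by omega⟩
  obtain ⟨_, hM⟩ := exists_isEmbeddedSubmanifold_basedSegmentSpace (n := n)
  obtain ⟨_, hL⟩ := exists_isEmbeddedSubmanifold_segmentSpace (n := n) (by omega)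
  exact ⟨_, _, hM, hL, exists_diffeomorph_basedSegmentSpace_prod hM hL⟩
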